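/- Consider a five-dimensional stationary axisymmetric vacuum space-time near a nut at which two spacelike rods meet. Let its metric be \[ ds^2=\sum_{i,j} J_{ij}\,dx^i dx^j+e^{2\nu}(dr^2+dz^2),\qquad (x^0,x^1,x^2)=(t,\varphi,\psi), \] where the symmetric real matrix $J$ and the real function $\nu$ are $C^2$ functions of $(r,z)$ on a half disc $r>0$, $r^2+z^2<\varepsilon^2$ (some $\varepsilon>0$), $\det J=-r^2$, and $\varphi,\psi$ have period $2\pi$. Assume the vacuum Einstein equations \[ \partial_r(rJ^{-1}\partial_rJ)+\partial_z(rJ^{-1}\partial_zJ)=0,\qquad \partial_\xi\log(re^{2\nu})=\tfrac{ir}{2}\operatorname{tr}(J^{-1}J_\xi J^{-1}J_\xi),\qquad \partial_\xi=\tfrac12(\partial_z-i\partial_r). \] Introduce $u,v\ge 0$ by $r=uv$, $z=\tfrac12(v^2-u^2)$, so that the nut is $u=v=0$, and assume that $J$ has the normal form \[ J=\begin{pmatrix}X_0&u^2Y_0&v^2Z_0\\ u^2Y_0&u^2U_0&u^2v^2V_0\\ v^2Z_0&u^2v^2V_0&v^2W_0\end{pmatrix}\qquad(u,v>0,\ u^2+v^2<2\varepsilon),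 \] where $X_0,Y_0,Z_0,U_0,V_0,W_0$ are functions of $(u,v)$ that are $C^1$ on $\{u,v\ge0,\ u^2+v^2<2\varepsilon\}$ (up to and including the axis), with $U_0>0$ on the rod $u=0$, $v>0$ (where $\partial_\varphi$ vanishes) and $W_0>0$ on the rod $v=0$, $u>0$ (where $\partial_\psi$ vanishes). Suppose that there are no conical singularities on the two rods: at each point of the rod $u=0$, $0<v<\sqrt{2\varepsilon}$, the length of the closed orbit of $\partial_\varphi$ through $(u,v)$ divided by the proper distance $\int_0^u e^{\nu(s,v)}\sqrt{s^2+v^2}\,ds$ from the rod tends to $2\pi$ as $u\to0^+$ (here $\nu(s,v)$ denotes $\nu$ at the point with $(u,v)$-coordinates $(s,v)$), and correspondingly for the orbits of $\partial_\psi$ at the rod $v=0$. Then the limits of $U_0$ along the rod $u=0$ and of $W_0$ along the rod $v=0$ at the nut exist and agree: \[ \lim_{v\to0^+}U_0(0,v)=\lim_{u\to0^+}W_0(u,0). \] -/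

import Mathlib

open Filter Topology

noncomputable section

namespace Nut

/-- `∂F/∂r` for a function `F(r,z)`. -/
def partialR (F : ℝ → ℝ → ℝ) (r z : ℝ) : ℝ := deriv (fun s => F s z) r

/-- `∂F/∂z` for a function `F(r,z)`. -/
def partialZ (F : ℝ → ℝ → ℝ) (r z : ℝ) : ℝ := deriv (fun s => F r s) z

/-- The derivative `∂F/∂ξ = (∂F/∂z - i ∂F/∂r)/2` with respect to `ξ = z + i r`. -/
def partialXi (F : ℝ → ℝ → ℝ) (r z : ℝ) : ℂ :=
  (1 / 2) * ((partialZ F r z : ℂ) - Complex.I * (partialR F r z : ℂ))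

/-- Entrywise `∂/∂r` of a matrix function of `(r,z)`. -/
def matR (J : ℝ → ℝ → Matrix (Fin 3) (Fin 3) ℝ) (r z : ℝ) : Matrix (Fin 3) (Fin 3) ℝ :=
  Matrix.of fun i j => partialR (fun s y => J s y i j) r z

/-- Entrywise `∂/∂z` of a matrix function of `(r,z)`. -/
def matZ (J : ℝ → ℝ → Matrix (Fin 3) (Fin 3) ℝ) (r z : ℝ) : Matrix (Fin 3) (Fin 3) ℝ :=
  Matrix.of fun i j => partialZ (fun s y => J s y i j) r z

/-- Entrywise `∂/∂ξ` of a matrix function of `(r,z)`. -/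
def matXi (J : ℝ → ℝ → Matrix (Fin 3) (Fin 3) ℝ) (r z : ℝ) : Matrix (Fin 3) (Fin 3) ℂ :=
  Matrix.of fun i j => partialXi (fun s y => J s y i j) r z

/-- The inverse of `J(r,z)`, regarded as a complex matrix. -/
def invC (J : ℝ → ℝ → Matrix (Fin 3) (Fin 3) ℝ) (r z : ℝ) : Matrix (Fin 3) (Fin 3) ℂ :=
  ((J r z)⁻¹).map (fun x : ℝ => (x : ℂ))

/-- The half disc `r > 0`, `r² + z² < ε²` in the `(r,z)` half plane; its centre is the nut. -/
def halfDisc (ε : ℝ) : Set (ℝ × ℝ) := {p | 0 < p.1 ∧ p.1 ^ 2 + p.2 ^ 2 < ε ^ 2}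

/-- The part `u ≥ 0`, `v ≥ 0`, `u² + v² < 2ε` of the `(u,v)` plane, including both rods
`u = 0`, `v = 0` and the nut. Under `r = uv`, `z = (v² - u²)/2` one has `u² + v² = 2 √(r² + z²)`,
so that its interior corresponds to `halfDisc ε`. -/
def quarterDisc (ε : ℝ) : Set (ℝ × ℝ) := {p | 0 ≤ p.1 ∧ 0 ≤ p.2 ∧ p.1 ^ 2 + p.2 ^ 2 < 2 * ε}

/-- The vacuum Einstein equations, on `halfDisc ε`, for the stationary axisymmetric metric
`∑ J_{ij}(r,z) dxⁱ dxʲ + e^{2ν(r,z)} (dr² + dz²)`, `(x⁰,x¹,x²) = (t,φ,ψ)`, in Weyl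
coordinates (`det J = -r²`):
`∂_r (r J⁻¹ ∂_r J) + ∂_z (r J⁻¹ ∂_z J) = 0` and
`∂_ξ log (r e^{2ν}) = (i r / 2) tr (J⁻¹ J_ξ J⁻¹ J_ξ)`, `ξ = z + i r`. -/
structure IsVacuum (J : ℝ → ℝ → Matrix (Fin 3) (Fin 3) ℝ) (ν : ℝ → ℝ → ℝ) (ε : ℝ) : Prop where
  contDiff_J : ∀ i j, ContDiffOn ℝ 2 (fun p : ℝ × ℝ => J p.1 p.2 i j) (halfDisc ε)
  contDiff_nu : ContDiffOn ℝ 2 (fun p : ℝ × ℝ => ν p.1 p.2) (halfDisc ε)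
  symm : ∀ r z, (r, z) ∈ halfDisc ε → (J r z).IsSymm
  det : ∀ r z, (r, z) ∈ halfDisc ε → (J r z).det = -r ^ 2
  sigma_model : ∀ r z, (r, z) ∈ halfDisc ε →
    matR (fun s y => s • ((J s y)⁻¹ * matR J s y)) r z +
      matZ (fun s y => s • ((J s y)⁻¹ * matZ J s y)) r z = 0
  conformal_factor : ∀ r z, (r, z) ∈ halfDisc ε →
    partialXi (fun s y => Real.log (s * Real.exp (2 * ν s y))) r z =
      (Complex.I * (r : ℂ) / 2) *
        (invC J r z * matXi J r z * invC J r z * matXi J r z).trace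

/-- The metric in the coordinates `(t,φ,ψ)` (left indices) and `(u,v)` (right indices), where
`r = uv` and `z = (v² - u²)/2`: the form `∑ J_{ij} dxⁱ dxʲ + e^{2ν} (u² + v²) (du² + dv²)`. -/
def metric (J : ℝ → ℝ → Matrix (Fin 3) (Fin 3) ℝ) (ν : ℝ → ℝ → ℝ) (u v : ℝ) :
    Matrix (Fin 3 ⊕ Fin 2) (Fin 3 ⊕ Fin 2) ℝ :=
  Matrix.fromBlocks (J (u * v) ((v ^ 2 - u ^ 2) / 2)) 0 0
    ((Real.exp (2 * ν (u * v) ((v ^ 2 - u ^ 2) / 2)) * (u ^ 2 + v ^ 2)) •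
      (1 : Matrix (Fin 2) (Fin 2) ℝ))

/-- `J` has, around the nut `u = v = 0`, the normal form
`(X₀, u²Y₀, v²Z₀; ·, u²U₀, u²v²V₀; ·, ·, v²W₀)`, with coefficients that are continuously
differentiable up to and including the rods and the nut; both adjacent rods are spacelike:
`∂_φ` vanishes on `u = 0`, `∂_ψ` vanishes on `v = 0`, and each is spacelike near its rod. -/
structure IsNutNormalForm (J : ℝ → ℝ → Matrix (Fin 3) (Fin 3) ℝ) (ε : ℝ)
    (X₀ Y₀ Z₀ U₀ V₀ W₀ : ℝ → ℝ → ℝ) : Prop where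
  contDiff_X : ContDiffOn ℝ 1 (fun p : ℝ × ℝ => X₀ p.1 p.2) (quarterDisc ε)
  contDiff_Y : ContDiffOn ℝ 1 (fun p : ℝ × ℝ => Y₀ p.1 p.2) (quarterDisc ε)
  contDiff_Z : ContDiffOn ℝ 1 (fun p : ℝ × ℝ => Z₀ p.1 p.2) (quarterDisc ε)
  contDiff_U : ContDiffOn ℝ 1 (fun p : ℝ × ℝ => U₀ p.1 p.2) (quarterDisc ε)
  contDiff_V : ContDiffOn ℝ 1 (fun p : ℝ × ℝ => V₀ p.1 p.2) (quarterDisc ε)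
  contDiff_W : ContDiffOn ℝ 1 (fun p : ℝ × ℝ => W₀ p.1 p.2) (quarterDisc ε)
  eq_form : ∀ u v, 0 < u → 0 < v → u ^ 2 + v ^ 2 < 2 * ε →
    J (u * v) ((v ^ 2 - u ^ 2) / 2) =
      !![X₀ u v, u ^ 2 * Y₀ u v, v ^ 2 * Z₀ u v;
         u ^ 2 * Y₀ u v, u ^ 2 * U₀ u v, u ^ 2 * v ^ 2 * V₀ u v;
         v ^ 2 * Z₀ u v, u ^ 2 * v ^ 2 * V₀ u v, v ^ 2 * W₀ u v]
  spacelike_phi : ∀ v, 0 < v → v ^ 2 < 2 * ε → 0 < U₀ 0 v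
  spacelike_psi : ∀ u, 0 < u → u ^ 2 < 2 * ε → 0 < W₀ u 0

/-- Length of the closed orbit of `∂_φ` (with `φ` of period `2π`) through the point `(u,v)`. -/
def circumferencePhi (J : ℝ → ℝ → Matrix (Fin 3) (Fin 3) ℝ) (ν : ℝ → ℝ → ℝ) (u v : ℝ) : ℝ :=
  ∫ _φ in (0 : ℝ)..(2 * Real.pi), Real.sqrt (metric J ν u v (Sum.inl 1) (Sum.inl 1))

/-- Length of the closed orbit of `∂_ψ` (with `ψ` of period `2π`) through the point `(u,v)`. -/
def circumferencePsi (J : ℝ → ℝ → Matrix (Fin 3) (Fin 3) ℝ) (ν : ℝ → ℝ → ℝ) (u v : ℝ) : ℝ :=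
  ∫ _ψ in (0 : ℝ)..(2 * Real.pi), Real.sqrt (metric J ν u v (Sum.inl 2) (Sum.inl 2))

/-- Proper distance from the rod `u = 0` to the point `(u,v)` along the line of constant `v`. -/
def radiusPhi (J : ℝ → ℝ → Matrix (Fin 3) (Fin 3) ℝ) (ν : ℝ → ℝ → ℝ) (u v : ℝ) : ℝ :=
  ∫ s in (0 : ℝ)..u, Real.sqrt (metric J ν s v (Sum.inr 0) (Sum.inr 0))

/-- Proper distance from the rod `v = 0` to the point `(u,v)` along the line of constant `u`. -/
def radiusPsi (J : ℝ → ℝ → Matrix (Fin 3) (Fin 3) ℝ) (ν : ℝ → ℝ → ℝ) (u v : ℝ) : ℝ :=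
  ∫ s in (0 : ℝ)..v, Real.sqrt (metric J ν u s (Sum.inr 1) (Sum.inr 1))

/-- No conical singularity on the rod `u = 0`: small circles around each of its points (other
than the nut) have circumference asymptotic to `2π` times their proper radius. -/
def NoConicalPhi (J : ℝ → ℝ → Matrix (Fin 3) (Fin 3) ℝ) (ν : ℝ → ℝ → ℝ) (ε : ℝ) : Prop :=
  ∀ v, 0 < v → v ^ 2 < 2 * ε →
    Tendsto (fun u => circumferencePhi J ν u v / radiusPhi J ν u v) (𝓝[>] 0) (𝓝 (2 * Real.pi))

/-- No conical singularity on the rod `v = 0`. -/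
def NoConicalPsi (J : ℝ → ℝ → Matrix (Fin 3) (Fin 3) ℝ) (ν : ℝ → ℝ → ℝ) (ε : ℝ) : Prop :=
  ∀ u, 0 < u → u ^ 2 < 2 * ε →
    Tendsto (fun v => circumferencePsi J ν u v / radiusPsi J ν u v) (𝓝[>] 0) (𝓝 (2 * Real.pi))

end Nut

end

/-!
Write `J = D K D` with `D = diag(1, u, v)` and `K` regular up to the rods, and let `E = D⁻¹ ∂D/∂ζ`
be the diagonal logarithmic derivative of `D` in the coordinate `ζ = v + iu`, so that `ξ = ζ²/2`.
Expanding `tr (J⁻¹ J_ζ)²` produces the double poles `4 tr E²` and a remainder that has only simple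
poles: the dangerous cross term is tamed by `2 tr (E K⁻¹ [E, K]) = -tr (K⁻¹ [E, K])²`, and `[E, K]`
is bounded because `K` is diagonal up to terms that vanish on the rods. In the equation for `ν` the
double poles are compensated exactly by `log r` and `log (u² + v²)`. Hence the derivative of
`log (e^{2ν} (u² + v²))` is bounded, and this function extends continuously to the nut. Absence of
conical singularities says that `U₀` and `W₀` equal the exponential of this extension on their rods,
so both tend to its value at the nut.
-/

namespace Nut

open Asymptotics Matrix

section TraceIdentity

variable {n R : Type*} [Fintype n] [DecidableEq n] [CommRing R]

lemma commutator_diagonal_apply (d : n → R) (A : Matrix n n R) (i j : n) :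
    ⁅diagonal d, A⁆ i j = (d i - d j) * A i j := by
  rw [Ring.lie_def, Matrix.sub_apply, diagonal_mul, mul_diagonal]
  ring

lemma trace_inv_mul_sq_congr {D : Matrix n n R} (hD : IsUnit D.det) (K N : Matrix n n R) :
    ((D * K * D)⁻¹ * (D * N * D) * (D * K * D)⁻¹ * (D * N * D)).trace =
      (K⁻¹ * N * K⁻¹ * N).trace := by
  have hDD : D⁻¹ * D = 1 := nonsing_inv_mul D hD
  have hconj : (D * K * D)⁻¹ * (D * N * D) = D⁻¹ * (K⁻¹ * N) * D := by
    calc (D * K * D)⁻¹ * (D * N * D) = D⁻¹ * K⁻¹ * (D⁻¹ * D) * N * D := by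
          simp only [Matrix.mul_inv_rev, Matrix.mul_assoc]
      _ = D⁻¹ * (K⁻¹ * N) * D := by rw [hDD, Matrix.mul_one, Matrix.mul_assoc D⁻¹]
  calc _ = (D⁻¹ * (K⁻¹ * N) * D * (D⁻¹ * (K⁻¹ * N) * D)).trace := by
        rw [Matrix.mul_assoc (_ * _), hconj]
    _ = (D * D⁻¹ * (K⁻¹ * N) * (D * D⁻¹) * (K⁻¹ * N)).trace := by
        rw [← Matrix.mul_assoc, trace_mul_comm]
        simp only [Matrix.mul_assoc]
    _ = (K⁻¹ * N * K⁻¹ * N).trace := by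
        rw [mul_nonsing_inv D hD]
        simp only [Matrix.one_mul, Matrix.mul_one, Matrix.mul_assoc]

lemma two_mul_trace_mul_inv_mul_commutator {K : Matrix n n R} (hK : IsUnit K.det)
    (E : Matrix n n R) :
    2 * (E * K⁻¹ * ⁅E, K⁆).trace = -(K⁻¹ * ⁅E, K⁆ * K⁻¹ * ⁅E, K⁆).trace := by
  have hPK : K⁻¹ * K = 1 := nonsing_inv_mul K hK
  have hcomm : K⁻¹ * ⁅E, K⁆ = K⁻¹ * E * K - E := by
    calc K⁻¹ * ⁅E, K⁆ = K⁻¹ * E * K - K⁻¹ * K * E := by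
          rw [Ring.lie_def, mul_sub, Matrix.mul_assoc, Matrix.mul_assoc]
      _ = _ := by rw [hPK, Matrix.one_mul]
  have hsq : (K⁻¹ * E * K * (K⁻¹ * E * K)).trace = (E * E).trace := by
    calc _ = (K⁻¹ * (E * (K * K⁻¹) * E * K)).trace := by simp only [Matrix.mul_assoc]
      _ = (E * E * (K * K⁻¹)).trace := by
          rw [mul_nonsing_inv K hK, Matrix.mul_one, trace_mul_comm, Matrix.mul_one,
            Matrix.mul_assoc, mul_nonsing_inv K hK, Matrix.mul_one]
      _ = (E * E).trace := by rw [mul_nonsing_inv K hK, Matrix.mul_one]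
  rw [Matrix.mul_assoc E, Matrix.mul_assoc (K⁻¹ * ⁅E, K⁆), hcomm]
  simp only [mul_sub, sub_mul, trace_sub, hsq, trace_mul_comm (K⁻¹ * E * K) E]
  ring

lemma map_nonsing_inv {S : Type*} [CommRing S] (f : R →+* S) {A : Matrix n n R}
    (hA : IsUnit A.det) : A⁻¹.map f = (A.map f)⁻¹ := by
  refine (inv_eq_right_inv ?_).symm
  rw [← Matrix.map_mul, mul_nonsing_inv A hA, Matrix.map_one f (map_zero f) (map_one f)]

/-- The terms of `tr (K⁻¹(EK + M + KE))²` other than `4 tr E²`. They are at most linear in `E`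
once the commutator `[E, K]` is under control, so that they have only simple poles where `E` has
simple poles. -/
noncomputable def traceRemainder (K E M : Matrix n n R) : R :=
  4 * (E * K⁻¹ * M).trace - (K⁻¹ * ⁅E, K⁆ * K⁻¹ * ⁅E, K⁆).trace +
    2 * (K⁻¹ * ⁅E, K⁆ * K⁻¹ * M).trace + (K⁻¹ * M * K⁻¹ * M).trace

lemma trace_inv_mul_sq_eq {K : Matrix n n R} (hK : IsUnit K.det) (E M : Matrix n n R) :
    (K⁻¹ * (E * K + M + K * E) * K⁻¹ * (E * K + M + K * E)).trace =
      4 * (E * E).trace + traceRemainder K E M := by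
  have hsplit : K⁻¹ * (E * K + M + K * E) = E + E + K⁻¹ * ⁅E, K⁆ + K⁻¹ * M := by
    calc _ = K⁻¹ * (⁅E, K⁆ + M + (K * E + K * E)) := by rw [Ring.lie_def]; congr 1; abel
      _ = K⁻¹ * K * E + K⁻¹ * K * E + K⁻¹ * ⁅E, K⁆ + K⁻¹ * M := by
          simp only [mul_add, Matrix.mul_assoc]; abel
      _ = _ := by rw [nonsing_inv_mul K hK, Matrix.one_mul]
  have hEN := two_mul_trace_mul_inv_mul_commutator hK E
  rw [Matrix.mul_assoc (_ * _), hsplit, traceRemainder]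
  simp only [Matrix.mul_assoc E, Matrix.mul_assoc (K⁻¹ * _)] at hEN ⊢
  simp only [mul_add, add_mul, trace_add, trace_mul_comm (K⁻¹ * ⁅E, K⁆) E,
    trace_mul_comm (K⁻¹ * M) E, trace_mul_comm (K⁻¹ * M) (K⁻¹ * ⁅E, K⁆)]
  linear_combination 2 * hEN

end TraceIdentity

section Growth

variable {α n : Type*} [Fintype n] {l : Filter α} {f g : α → ℝ}

lemma isBigO_mul_apply {A B : α → Matrix n n ℂ} (hA : ∀ i j, (fun a => A a i j) =O[l] f)
    (hB : ∀ i j, (fun a => B a i j) =O[l] g) (i j : n) :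
    (fun a => (A a * B a) i j) =O[l] fun a => f a * g a := by
  simp only [Matrix.mul_apply]
  exact IsBigO.fun_sum fun k _ => (hA i k).mul (hB k j)

lemma isBigO_trace {A : α → Matrix n n ℂ} (hA : ∀ i j, (fun a => A a i j) =O[l] f) :
    (fun a => (A a).trace) =O[l] f :=
  IsBigO.fun_sum fun i _ => hA i i

lemma isBigO_traceRemainder [DecidableEq n] {K E M : α → Matrix n n ℂ}
    (hK : ∀ i j, (fun a => (K a)⁻¹ i j) =O[l] fun _ => (1 : ℝ))
    (hE : ∀ i j, (fun a => E a i j) =O[l] f)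
    (hEK : ∀ i j, (fun a => ⁅E a, K a⁆ i j) =O[l] fun _ => (1 : ℝ))
    (hM : ∀ i j, (fun a => M a i j) =O[l] fun _ => (1 : ℝ))
    (hf : (fun _ => (1 : ℝ)) =O[l] f) :
    (fun a => traceRemainder (K a) (E a) (M a)) =O[l] f := by
  have hPN := isBigO_mul_apply hK hEK
  have hPM := isBigO_mul_apply hK hM
  have hEPM := isBigO_trace (isBigO_mul_apply (isBigO_mul_apply hE hK) hM)
  have hPNPN := isBigO_trace (isBigO_mul_apply (isBigO_mul_apply hPN hK) hEK)
  have hPNPM := isBigO_trace (isBigO_mul_apply (isBigO_mul_apply hPN hK) hM)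
  have hPMPM := isBigO_trace (isBigO_mul_apply (isBigO_mul_apply hPM hK) hM)
  simp only [mul_one] at hEPM hPNPN hPNPM hPMPM
  exact (((hEPM.const_mul_left 4).sub (hPNPN.trans hf)).add
    ((hPNPM.const_mul_left 2).trans hf)).add (hPMPM.trans hf)

end Growth

section PartialXi

variable {F G : ℝ → ℝ → ℝ} {u v C : ℝ} {F' G' : ℝ × ℝ →L[ℝ] ℝ}

lemma hasDerivAt_left (h : HasFDerivAt (fun p : ℝ × ℝ => F p.1 p.2) F' (u, v)) :
    HasDerivAt (fun s => F s v) (F' (1, 0)) u :=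
  h.comp_hasDerivAt_of_eq u ((hasDerivAt_id u).prodMk (hasDerivAt_const u v)) rfl

lemma hasDerivAt_right (h : HasFDerivAt (fun p : ℝ × ℝ => F p.1 p.2) F' (u, v)) :
    HasDerivAt (fun s => F u s) (F' (0, 1)) v :=
  h.comp_hasDerivAt_of_eq v ((hasDerivAt_const v u).prodMk (hasDerivAt_id v)) rfl

lemma partialXi_eq_of_hasFDerivAt (h : HasFDerivAt (fun p : ℝ × ℝ => F p.1 p.2) F' (u, v)) :
    partialXi F u v = (1 / 2) * ((F' (0, 1) : ℂ) - Complex.I * (F' (1, 0) : ℂ)) := by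
  rw [partialXi, partialR, partialZ, (hasDerivAt_left h).deriv, (hasDerivAt_right h).deriv]

lemma partialXi_congr
    (h : (fun p : ℝ × ℝ => F p.1 p.2) =ᶠ[𝓝 (u, v)] fun p => G p.1 p.2) :
    partialXi F u v = partialXi G u v := by
  have hleft : (fun s => F s v) =ᶠ[𝓝 u] fun s => G s v :=
    (Continuous.prodMk_left v).continuousAt.eventually h
  have hright : (fun s => F u s) =ᶠ[𝓝 v] fun s => G u s :=
    (Continuous.prodMk_right u).continuousAt.eventually h
  rw [partialXi, partialXi, partialR, partialR, partialZ, partialZ, hleft.deriv_eq,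
    hright.deriv_eq]

lemma partialXi_add (hF : DifferentiableAt ℝ (fun p : ℝ × ℝ => F p.1 p.2) (u, v))
    (hG : DifferentiableAt ℝ (fun p : ℝ × ℝ => G p.1 p.2) (u, v)) :
    partialXi (fun s t => F s t + G s t) u v = partialXi F u v + partialXi G u v := by
  rw [partialXi_eq_of_hasFDerivAt hF.hasFDerivAt, partialXi_eq_of_hasFDerivAt hG.hasFDerivAt,
    partialXi_eq_of_hasFDerivAt (hF.hasFDerivAt.fun_add hG.hasFDerivAt)]
  simp only [_root_.add_apply, Complex.ofReal_add]
  ring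

lemma partialXi_mul (hF : DifferentiableAt ℝ (fun p : ℝ × ℝ => F p.1 p.2) (u, v))
    (hG : DifferentiableAt ℝ (fun p : ℝ × ℝ => G p.1 p.2) (u, v)) :
    partialXi (fun s t => F s t * G s t) u v =
      partialXi F u v * G u v + F u v * partialXi G u v := by
  rw [partialXi_eq_of_hasFDerivAt hF.hasFDerivAt, partialXi_eq_of_hasFDerivAt hG.hasFDerivAt,
    partialXi_eq_of_hasFDerivAt (hF.hasFDerivAt.fun_mul hG.hasFDerivAt)]
  simp only [_root_.add_apply, _root_.smul_apply, smul_eq_mul,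
    Complex.ofReal_add, Complex.ofReal_mul]
  ring

lemma norm_fderiv_le_of_norm_partialXi_le
    (h : DifferentiableAt ℝ (fun p : ℝ × ℝ => F p.1 p.2) (u, v)) (hC : ‖partialXi F u v‖ ≤ C) :
    ‖fderiv ℝ (fun p : ℝ × ℝ => F p.1 p.2) (u, v)‖ ≤ 4 * C := by
  set L := fderiv ℝ (fun p : ℝ × ℝ => F p.1 p.2) (u, v)
  have hXi : partialXi F u v = (L (0, 1) / 2 : ℝ) + (-(L (1, 0) / 2) : ℝ) * Complex.I := by
    rw [partialXi_eq_of_hasFDerivAt h.hasFDerivAt]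
    push_cast
    ring
  have him : |L (1, 0) / 2| ≤ C := by
    simpa only [hXi, Complex.add_im, Complex.ofReal_im, Complex.im_ofReal_mul, Complex.I_im,
      mul_one, zero_add, abs_neg] using (Complex.abs_im_le_norm (partialXi F u v)).trans hC
  have hre : |L (0, 1) / 2| ≤ C := by
    simpa only [hXi, Complex.add_re, Complex.ofReal_re, Complex.re_ofReal_mul, Complex.I_re,
      mul_zero, add_zero] using (Complex.abs_re_le_norm (partialXi F u v)).trans hC
  rw [abs_div, abs_two, div_le_iff₀' two_pos] at him hre
  refine L.opNorm_le_bound (by linarith [(norm_nonneg _).trans hC]) fun q => ?_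
  have hq : L q = q.1 * L (1, 0) + q.2 * L (0, 1) := by
    rw [← smul_eq_mul, ← smul_eq_mul, ← map_smul, ← map_smul, ← map_add]
    simp
  calc ‖L q‖ ≤ |q.1| * |L (1, 0)| + |q.2| * |L (0, 1)| := by
        rw [hq, ← abs_mul, ← abs_mul]
        exact abs_add_le _ _
    _ ≤ ‖q‖ * (2 * C) + ‖q‖ * (2 * C) := by
        gcongr
        · exact norm_fst_le q
        · exact norm_snd_le q
    _ = 4 * C * ‖q‖ := by ring

end PartialXi

section WeylCoordinates

variable {u v : ℝ}

/-- The complex coordinate `ζ = v + iu`, related to `ξ = z + ir` by `ξ = ζ² / 2`. -/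
noncomputable def zeta (u v : ℝ) : ℂ := v + Complex.I * u

lemma le_norm_zeta_left : u ≤ ‖zeta u v‖ := by
  simpa [zeta] using Complex.im_le_norm (zeta u v)

lemma le_norm_zeta_right : v ≤ ‖zeta u v‖ := by
  simpa [zeta] using Complex.re_le_norm (zeta u v)

lemma zeta_ne_zero (hu : 0 < u) : zeta u v ≠ 0 :=
  norm_pos_iff.1 (hu.trans_le le_norm_zeta_left)

lemma partialXi_comp_weyl {F : ℝ → ℝ → ℝ}
    (h : DifferentiableAt ℝ (fun p : ℝ × ℝ => F p.1 p.2) (u * v, (v ^ 2 - u ^ 2) / 2)) :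
    partialXi (fun s t => F (s * t) ((t ^ 2 - s ^ 2) / 2)) u v =
      zeta u v * partialXi F (u * v) ((v ^ 2 - u ^ 2) / 2) := by
  set L := fderiv ℝ (fun p : ℝ × ℝ => F p.1 p.2) (u * v, (v ^ 2 - u ^ 2) / 2)
  have hL (a b : ℝ) : L (a, b) = a * L (1, 0) + b * L (0, 1) := by
    rw [← smul_eq_mul, ← smul_eq_mul, ← map_smul, ← map_smul, ← map_add]
    simp
  have hu : HasDerivAt (fun s => F (s * v) ((v ^ 2 - s ^ 2) / 2)) (L (v, -u)) u := by
    have hr : HasDerivAt (fun s : ℝ => s * v) v u := hasDerivAt_mul_const v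
    have hz : HasDerivAt (fun s : ℝ => (v ^ 2 - s ^ 2) / 2) (-u) u :=
      (((hasDerivAt_pow 2 u).const_sub (v ^ 2)).div_const 2).congr_deriv (by push_cast; ring)
    exact h.hasFDerivAt.comp_hasDerivAt_of_eq u (hr.prodMk hz) rfl
  have hv : HasDerivAt (fun t => F (u * t) ((t ^ 2 - u ^ 2) / 2)) (L (u, v)) v := by
    have hr : HasDerivAt (fun t : ℝ => u * t) u v := hasDerivAt_const_mul u
    have hz : HasDerivAt (fun t : ℝ => (t ^ 2 - u ^ 2) / 2) v v :=
      (((hasDerivAt_pow 2 v).sub_const (u ^ 2)).div_const 2).congr_deriv (by simp)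
    exact h.hasFDerivAt.comp_hasDerivAt_of_eq v (hr.prodMk hz) rfl
  rw [partialXi_eq_of_hasFDerivAt h.hasFDerivAt, partialXi, partialR, partialZ, hu.deriv, hv.deriv,
    hL v (-u), hL u v, zeta]
  push_cast
  linear_combination (1 / 2) * (u : ℂ) * (L (1, 0) : ℂ) * Complex.I_sq

lemma partialXi_log_fst (hu : u ≠ 0) :
    partialXi (fun s _ => Real.log s) u v = -Complex.I / (2 * u) := by
  have hu' : (u : ℂ) ≠ 0 := mod_cast hu
  simp only [partialXi, partialR, partialZ, deriv_const, Real.deriv_log, Complex.ofReal_zero,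
    Complex.ofReal_inv]
  field_simp
  ring

lemma partialXi_log_sq_add_sq (h : zeta u v ≠ 0) :
    partialXi (fun s t => Real.log (s ^ 2 + t ^ 2)) u v = 1 / zeta u v := by
  have hfactor : zeta u v * (v - Complex.I * u) = ((u ^ 2 + v ^ 2 : ℝ) : ℂ) := by
    rw [zeta]
    push_cast
    linear_combination -(u : ℂ) ^ 2 * Complex.I_sq
  have hne : u ^ 2 + v ^ 2 ≠ 0 := fun h0 => by
    obtain ⟨rfl, rfl⟩ : u = 0 ∧ v = 0 := by constructor <;> nlinarith [sq_nonneg u, sq_nonneg v]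
    simp [zeta] at h
  have hu : HasDerivAt (fun s => Real.log (s ^ 2 + v ^ 2)) (2 * u / (u ^ 2 + v ^ 2)) u :=
    (((hasDerivAt_pow 2 u).add_const (v ^ 2)).log hne).congr_deriv (by simp)
  have hv : HasDerivAt (fun t => Real.log (u ^ 2 + t ^ 2)) (2 * v / (u ^ 2 + v ^ 2)) v :=
    (((hasDerivAt_pow 2 v).const_add (u ^ 2)).log hne).congr_deriv (by simp)
  rw [partialXi, partialR, partialZ, hu.deriv, hv.deriv, eq_div_iff h, Complex.ofReal_div,
    Complex.ofReal_div, ← hfactor]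
  have hconj : (v - Complex.I * u : ℂ) ≠ 0 := by
    refine right_ne_zero_of_mul (a := zeta u v) ?_
    rw [hfactor]
    exact mod_cast hne
  field_simp
  push_cast
  ring

end WeylCoordinates
section Frame

variable {u v : ℝ}

/-- The diagonal entries of the matrix `D = diag(1, u, v)` that carries the degeneration of `J` at
the rods. -/
def frame (u v : ℝ) : Fin 3 → ℝ := ![1, u, v]

/-- The diagonal entries of the logarithmic derivative `E = D⁻¹ ∂D/∂ζ` of `D = diag(1, u, v)`. -/
noncomputable def frameLogDeriv (u v : ℝ) : Fin 3 → ℂ :=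
  ![0, -Complex.I / (2 * u), 1 / (2 * v)]

lemma differentiable_frame (i : Fin 3) : Differentiable ℝ fun p : ℝ × ℝ => frame p.1 p.2 i := by
  fin_cases i
  exacts [differentiable_const 1, differentiable_fst, differentiable_snd]

lemma partialXi_frame (hu : u ≠ 0) (hv : v ≠ 0) (i : Fin 3) :
    partialXi (fun s t => frame s t i) u v = frame u v i * frameLogDeriv u v i := by
  have hu' : (u : ℂ) ≠ 0 := mod_cast hu
  have hv' : (v : ℂ) ≠ 0 := mod_cast hv
  fin_cases i <;>
    simp only [partialXi, partialR, partialZ, frame, frameLogDeriv, Fin.zero_eta, Fin.mk_one,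
      Fin.reduceFinMk, cons_val, deriv_const', deriv_id'', Complex.ofReal_zero,
      Complex.ofReal_one] <;>
    field_simp <;> ring

lemma det_diagonal_frame : (diagonal (frame u v)).det = u * v := by
  simp [frame, Fin.prod_univ_three]

lemma trace_diagonal_frameLogDeriv_sq (hu : u ≠ 0) (hv : v ≠ 0) :
    (diagonal (frameLogDeriv u v) * diagonal (frameLogDeriv u v)).trace =
      -1 / (4 * (u : ℂ) ^ 2) + 1 / (4 * (v : ℂ) ^ 2) := by
  have hu' : (u : ℂ) ≠ 0 := mod_cast hu
  have hv' : (v : ℂ) ≠ 0 := mod_cast hv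
  simp only [diagonal_mul_diagonal, trace_diagonal, Fin.sum_univ_three, frameLogDeriv,
    Matrix.cons_val]
  field_simp
  linear_combination 4 * (v : ℂ) ^ 2 * Complex.I_sq

lemma norm_frameLogDeriv_le (hu : 0 < u) (hv : 0 < v) (i : Fin 3) :
    ‖frameLogDeriv u v i‖ ≤ ‖zeta u v‖ / (u * v) := by
  have hzeta₁ : 1 / v ≤ ‖zeta u v‖ / (u * v) := by
    rw [div_le_div_iff₀ hv (by positivity)]
    nlinarith [le_norm_zeta_left (u := u) (v := v)]
  have hzeta₂ : 1 / u ≤ ‖zeta u v‖ / (u * v) := by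
    rw [div_le_div_iff₀ hu (by positivity)]
    nlinarith [le_norm_zeta_right (u := u) (v := v)]
  have hu' : 1 / (2 * u) ≤ 1 / u := by gcongr; linarith
  have hv' : 1 / (2 * v) ≤ 1 / v := by gcongr; linarith
  fin_cases i
  · simpa [frameLogDeriv] using (one_div_pos.2 hu).le.trans hzeta₂
  · simpa [frameLogDeriv, abs_of_pos hu] using hu'.trans hzeta₂
  · simpa [frameLogDeriv, abs_of_pos hv] using hv'.trans hzeta₁

end Frame

section MatXi

variable {J K N : ℝ → ℝ → Matrix (Fin 3) (Fin 3) ℝ} {u v : ℝ}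

lemma invC_eq_map_inv {r z : ℝ} (h : IsUnit (J r z).det) :
    invC J r z = ((J r z).map Complex.ofReal)⁻¹ :=
  map_nonsing_inv Complex.ofRealHom h

lemma matXi_congr
    (h : (fun p : ℝ × ℝ => J p.1 p.2) =ᶠ[𝓝 (u, v)] fun p => K p.1 p.2) :
    matXi J u v = matXi K u v := by
  ext i j
  exact partialXi_congr (h.fun_comp fun A => A i j)

lemma matXi_comp_weyl
    (hJ : ∀ i j, DifferentiableAt ℝ (fun p : ℝ × ℝ => J p.1 p.2 i j)
      (u * v, (v ^ 2 - u ^ 2) / 2)) :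
    matXi (fun s t => J (s * t) ((t ^ 2 - s ^ 2) / 2)) u v =
      zeta u v • matXi J (u * v) ((v ^ 2 - u ^ 2) / 2) := by
  ext i j
  exact partialXi_comp_weyl (F := fun r z => J r z i j) (hJ i j)

lemma matXi_frame_conj (hu : u ≠ 0) (hv : v ≠ 0)
    (hK : ∀ i j, DifferentiableAt ℝ (fun p : ℝ × ℝ => K p.1 p.2 i j) (u, v)) :
    matXi (fun s t => diagonal (frame s t) * K s t * diagonal (frame s t)) u v =
      (diagonal (frame u v)).map Complex.ofReal *
        (diagonal (frameLogDeriv u v) * (K u v).map Complex.ofReal + matXi K u v +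
          (K u v).map Complex.ofReal * diagonal (frameLogDeriv u v)) *
        (diagonal (frame u v)).map Complex.ofReal := by
  ext i j
  have hi := differentiable_frame i (u, v)
  have hj := differentiable_frame j (u, v)
  have hprod : partialXi (fun s t => frame s t i * K s t i j * frame s t j) u v =
      frame u v i * (frameLogDeriv u v i * K u v i j + partialXi (fun s t => K s t i j) u v +
        K u v i j * frameLogDeriv u v j) * frame u v j := by
    rw [partialXi_mul (hi.mul (hK i j)) hj, partialXi_mul hi (hK i j), partialXi_frame hu hv,
      partialXi_frame hu hv]
    push_cast
    ring
  simpa only [matXi, of_apply, diagonal_map Complex.ofReal_zero, diagonal_mul, mul_diagonal,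
    Matrix.add_apply, map_apply] using hprod

lemma zeta_sq_mul_trace_eq (hu : u ≠ 0) (hv : v ≠ 0)
    (hJ : ∀ i j, DifferentiableAt ℝ (fun p : ℝ × ℝ => J p.1 p.2 i j)
      (u * v, (v ^ 2 - u ^ 2) / 2))
    (hK : ∀ i j, DifferentiableAt ℝ (fun p : ℝ × ℝ => K p.1 p.2 i j) (u, v))
    (hdet : IsUnit (K u v).det)
    (hJK : (fun p : ℝ × ℝ => J (p.1 * p.2) ((p.2 ^ 2 - p.1 ^ 2) / 2)) =ᶠ[𝓝 (u, v)]
      fun p => diagonal (frame p.1 p.2) * K p.1 p.2 * diagonal (frame p.1 p.2)) :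
    zeta u v ^ 2 * (invC J (u * v) ((v ^ 2 - u ^ 2) / 2) *
      matXi J (u * v) ((v ^ 2 - u ^ 2) / 2) * invC J (u * v) ((v ^ 2 - u ^ 2) / 2) *
      matXi J (u * v) ((v ^ 2 - u ^ 2) / 2)).trace =
      -1 / (u : ℂ) ^ 2 + 1 / (v : ℂ) ^ 2 + traceRemainder ((K u v).map Complex.ofReal)
        (diagonal (frameLogDeriv u v)) (matXi K u v) := by
  have hD : IsUnit (diagonal (frame u v)).det := by
    rw [det_diagonal_frame]
    exact (mul_ne_zero hu hv).isUnit
  have isUnit_det_map {A : Matrix (Fin 3) (Fin 3) ℝ} (hA : IsUnit A.det) :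
      IsUnit (A.map Complex.ofReal).det :=
    Complex.ofRealHom.map_det A ▸ hA.map Complex.ofRealHom
  have hinv : invC J (u * v) ((v ^ 2 - u ^ 2) / 2) =
      ((diagonal (frame u v)).map Complex.ofReal * (K u v).map Complex.ofReal *
        (diagonal (frame u v)).map Complex.ofReal)⁻¹ := by
    have hdetJ : IsUnit (J (u * v) ((v ^ 2 - u ^ 2) / 2)).det := by
      rw [hJK.eq_of_nhds, Matrix.det_mul, Matrix.det_mul]
      exact (hD.mul hdet).mul hD
    rw [invC_eq_map_inv hdetJ, hJK.eq_of_nhds]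
    change (Matrix.map _ Complex.ofRealHom)⁻¹ = _
    rw [Matrix.map_mul, Matrix.map_mul]
    rfl
  have hXi := (matXi_comp_weyl hJ).symm.trans ((matXi_congr hJK).trans (matXi_frame_conj hu hv hK))
  calc _ = (invC J (u * v) ((v ^ 2 - u ^ 2) / 2) *
          (zeta u v • matXi J (u * v) ((v ^ 2 - u ^ 2) / 2)) *
          invC J (u * v) ((v ^ 2 - u ^ 2) / 2) *
          (zeta u v • matXi J (u * v) ((v ^ 2 - u ^ 2) / 2))).trace := by
        simp only [Matrix.mul_smul, Matrix.smul_mul, trace_smul, smul_eq_mul]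
        ring
    _ = _ := by
        rw [hinv, hXi, trace_inv_mul_sq_congr (isUnit_det_map hD),
          trace_inv_mul_sq_eq (isUnit_det_map hdet), trace_diagonal_frameLogDeriv_sq hu hv]
        ring

end MatXi

section Discs

variable {ε u v : ℝ} {p : ℝ × ℝ}

lemma isOpen_halfDisc : IsOpen (halfDisc ε) :=
  (isOpen_lt continuous_const continuous_fst).inter
    (isOpen_lt (f := fun p : ℝ × ℝ => p.1 ^ 2 + p.2 ^ 2) (by fun_prop) continuous_const)

lemma quarterDisc_eq_inter : quarterDisc ε =
    (Set.Ici 0 ×ˢ Set.Ici 0) ∩ {p : ℝ × ℝ | p.1 ^ 2 + p.2 ^ 2 < 2 * ε} := by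
  ext p
  simp [quarterDisc, and_assoc, Prod.le_def]

lemma isOpen_setOf_sq_add_sq_lt : IsOpen {p : ℝ × ℝ | p.1 ^ 2 + p.2 ^ 2 < 2 * ε} :=
  isOpen_lt (by fun_prop) continuous_const

lemma interior_quarterDisc : interior (quarterDisc ε) =
    (Set.Ioi 0 ×ˢ Set.Ioi 0) ∩ {p : ℝ × ℝ | p.1 ^ 2 + p.2 ^ 2 < 2 * ε} := by
  rw [quarterDisc_eq_inter, interior_inter, interior_prod_eq, interior_Ici,
    isOpen_setOf_sq_add_sq_lt.interior_eq]

lemma mem_interior_quarterDisc : p ∈ interior (quarterDisc ε) ↔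
    0 < p.1 ∧ 0 < p.2 ∧ p.1 ^ 2 + p.2 ^ 2 < 2 * ε := by
  simp [interior_quarterDisc, and_assoc]

lemma convex_quarterDisc : Convex ℝ (quarterDisc ε) := by
  have hsq : ConvexOn ℝ Set.univ fun x : ℝ => x ^ 2 := even_two.convexOn_pow
  have hsum : ConvexOn ℝ Set.univ fun p : ℝ × ℝ => p.1 ^ 2 + p.2 ^ 2 :=
    (hsq.comp_linearMap (LinearMap.fst ℝ ℝ ℝ)).add (hsq.comp_linearMap (LinearMap.snd ℝ ℝ ℝ))
  rw [quarterDisc_eq_inter]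
  exact ((convex_Ici 0).prod (convex_Ici 0)).inter (by simpa using hsum.convex_lt (2 * ε))

lemma zero_mem_quarterDisc (hε : 0 < ε) : (0 : ℝ × ℝ) ∈ quarterDisc ε := by
  simp [quarterDisc, hε]

lemma nhdsWithin_interior_quarterDisc (hε : 0 < ε) :
    𝓝[interior (quarterDisc ε)] (0 : ℝ × ℝ) = 𝓝[>] 0 ×ˢ 𝓝[>] 0 := by
  rw [interior_quarterDisc, ← nhdsWithin_prod_eq]
  exact nhdsWithin_inter_of_mem' (mem_nhdsWithin_of_mem_nhds
    (isOpen_setOf_sq_add_sq_lt.mem_nhds (by simpa using hε)))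

lemma uniqueDiffOn_quarterDisc (hε : 0 < ε) : UniqueDiffOn ℝ (quarterDisc ε) := by
  refine uniqueDiffOn_convex convex_quarterDisc (Filter.nonempty_of_mem (f := 𝓝[>] 0 ×ˢ 𝓝[>] 0) ?_)
  rw [← nhdsWithin_interior_quarterDisc hε]
  exact self_mem_nhdsWithin

lemma weyl_mem_halfDisc (h : (u, v) ∈ interior (quarterDisc ε)) :
    (u * v, (v ^ 2 - u ^ 2) / 2) ∈ halfDisc ε := by
  obtain ⟨hu, hv, huv⟩ := mem_interior_quarterDisc.1 h
  refine ⟨mul_pos hu hv, ?_⟩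
  calc (u * v) ^ 2 + ((v ^ 2 - u ^ 2) / 2) ^ 2 = ((u ^ 2 + v ^ 2) / 2) ^ 2 := by ring
    _ < ε ^ 2 := pow_lt_pow_left₀ (by linarith) (by positivity) two_ne_zero

end Discs

lemma isBigO_partialXi {F : ℝ → ℝ → ℝ} {s : Set (ℝ × ℝ)} {x : ℝ × ℝ} (hs : UniqueDiffOn ℝ s)
    (hF : ContDiffOn ℝ 1 (fun p : ℝ × ℝ => F p.1 p.2) s) (hx : x ∈ s) :
    (fun p : ℝ × ℝ => partialXi F p.1 p.2) =O[𝓝[interior s] x] fun _ => (1 : ℝ) := by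
  have hF' (w : ℝ × ℝ) :
      ContinuousOn (fun p => (fderivWithin ℝ (fun p : ℝ × ℝ => F p.1 p.2) s p w : ℂ)) s :=
    Complex.continuous_ofReal.comp_continuousOn
      ((hF.continuousOn_fderivWithin hs le_rfl).clm_apply continuousOn_const)
  have hXi := (((hF' (0, 1)).fun_sub ((hF' (1, 0)).const_mul Complex.I)).const_mul (1 / 2)) x hx
  refine (Tendsto.isBigO_one ℝ (hXi.mono interior_subset)).congr' ?_ EventuallyEq.rfl
  filter_upwards [self_mem_nhdsWithin] with p hp
  have hdiff : DifferentiableAt ℝ (fun p : ℝ × ℝ => F p.1 p.2) p :=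
    (hF.contDiffAt (mem_interior_iff_mem_nhds.1 hp)).differentiableAt one_ne_zero
  rw [partialXi_eq_of_hasFDerivAt hdiff.hasFDerivAt,
    fderivWithin_of_mem_nhds (mem_interior_iff_mem_nhds.1 hp)]

section RegularPart

variable {J K : ℝ → ℝ → Matrix (Fin 3) (Fin 3) ℝ} {ν : ℝ → ℝ → ℝ} {ε u v : ℝ}

/-- `K` is a regular part of `J` at the nut: `J = D K D` with `D = diag(1, u, v)`, where `K` is
continuously differentiable up to the rods and its commutator with the pole `E` of
`D⁻¹ ∂D/∂ζ` stays bounded at the nut. -/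
structure IsRegularPart (J K : ℝ → ℝ → Matrix (Fin 3) (Fin 3) ℝ) (ε : ℝ) : Prop where
  contDiffOn : ∀ i j, ContDiffOn ℝ 1 (fun p : ℝ × ℝ => K p.1 p.2 i j) (quarterDisc ε)
  eq_frame_conj : ∀ u v, (u, v) ∈ interior (quarterDisc ε) →
    J (u * v) ((v ^ 2 - u ^ 2) / 2) = diagonal (frame u v) * K u v * diagonal (frame u v)
  isBigO_commutator : ∀ i j, (fun p : ℝ × ℝ =>
    ⁅diagonal (frameLogDeriv p.1 p.2), (K p.1 p.2).map Complex.ofReal⁆ i j)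
      =O[𝓝[interior (quarterDisc ε)] 0] fun _ => (1 : ℝ)

/-- The part of the vacuum Einstein equations that determines the conformal factor `e^{2ν}` from
`J`, in Weyl coordinates on `halfDisc ε`. -/
structure SolvesConformalEquation (J : ℝ → ℝ → Matrix (Fin 3) (Fin 3) ℝ) (ν : ℝ → ℝ → ℝ)
    (ε : ℝ) : Prop where
  differentiableOn_metric :
    ∀ i j, DifferentiableOn ℝ (fun p : ℝ × ℝ => J p.1 p.2 i j) (halfDisc ε)
  differentiableOn_nu : DifferentiableOn ℝ (fun p : ℝ × ℝ => ν p.1 p.2) (halfDisc ε)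
  det_eq : ∀ r z, (r, z) ∈ halfDisc ε → (J r z).det = -r ^ 2
  partialXi_log_eq : ∀ r z, (r, z) ∈ halfDisc ε →
    partialXi (fun s y => Real.log (s * Real.exp (2 * ν s y))) r z =
      (Complex.I * (r : ℂ) / 2) *
        (invC J r z * matXi J r z * invC J r z * matXi J r z).trace

lemma IsVacuum.solvesConformalEquation (h : IsVacuum J ν ε) : SolvesConformalEquation J ν ε where
  differentiableOn_metric i j := (h.contDiff_J i j).differentiableOn two_ne_zero
  differentiableOn_nu := h.contDiff_nu.differentiableOn two_ne_zero
  det_eq := h.det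
  partialXi_log_eq := h.conformal_factor

lemma IsRegularPart.differentiableAt (hK : IsRegularPart J K ε)
    (h : (u, v) ∈ interior (quarterDisc ε)) (i j : Fin 3) :
    DifferentiableAt ℝ (fun p : ℝ × ℝ => K p.1 p.2 i j) (u, v) :=
  ((hK.contDiffOn i j).contDiffAt (mem_interior_iff_mem_nhds.1 h)).differentiableAt one_ne_zero

lemma IsRegularPart.det_eq (hK : IsRegularPart J K ε)
    (hdet : ∀ r z, (r, z) ∈ halfDisc ε → (J r z).det = -r ^ 2)
    (h : (u, v) ∈ interior (quarterDisc ε)) : (K u v).det = -1 := by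
  obtain ⟨hu, hv, -⟩ := mem_interior_quarterDisc.1 h
  have hJ := hdet _ _ (weyl_mem_halfDisc h)
  rw [hK.eq_frame_conj u v h, Matrix.det_mul, Matrix.det_mul, det_diagonal_frame] at hJ
  have huv : (u * v) ^ 2 ≠ 0 := pow_ne_zero 2 (mul_pos hu hv).ne'
  apply mul_left_cancel₀ huv
  linear_combination hJ

lemma IsRegularPart.isBigO_inv (hK : IsRegularPart J K ε) (hε : 0 < ε)
    (hdet : ∀ r z, (r, z) ∈ halfDisc ε → (J r z).det = -r ^ 2) (i j : Fin 3) :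
    (fun p : ℝ × ℝ => ((K p.1 p.2).map Complex.ofReal)⁻¹ i j)
      =O[𝓝[interior (quarterDisc ε)] 0] fun _ => (1 : ℝ) := by
  have hcont : ContinuousOn (fun p : ℝ × ℝ => K p.1 p.2) (quarterDisc ε) :=
    continuousOn_pi.2 fun i => continuousOn_pi.2 fun j => (hK.contDiffOn i j).continuousOn
  have hadj : ContinuousOn (fun p : ℝ × ℝ => (-(K p.1 p.2).adjugate i j : ℂ)) (quarterDisc ε) :=
    (Complex.continuous_ofReal.comp
      (continuous_id.matrix_adjugate.matrix_elem i j)).neg.comp_continuousOn hcont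
  refine (Tendsto.isBigO_one ℝ
    ((hadj 0 (zero_mem_quarterDisc hε)).mono interior_subset)).congr' ?_ EventuallyEq.rfl
  filter_upwards [self_mem_nhdsWithin] with p hp
  have hunit : IsUnit (K p.1 p.2).det := by
    rw [hK.det_eq hdet hp]
    exact isUnit_one.neg
  have hinv : ((K p.1 p.2).map Complex.ofReal)⁻¹ = (K p.1 p.2)⁻¹.map Complex.ofReal :=
    (map_nonsing_inv Complex.ofRealHom hunit).symm
  rw [hinv, map_apply, Matrix.inv_def, hK.det_eq hdet hp, Ring.inverse_eq_inv']
  simp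

lemma IsRegularPart.isBigO_traceRemainder (hK : IsRegularPart J K ε) (hε : 0 < ε)
    (hdet : ∀ r z, (r, z) ∈ halfDisc ε → (J r z).det = -r ^ 2) :
    (fun p : ℝ × ℝ => traceRemainder ((K p.1 p.2).map Complex.ofReal)
      (diagonal (frameLogDeriv p.1 p.2)) (matXi K p.1 p.2))
      =O[𝓝[interior (quarterDisc ε)] 0] fun p => ‖zeta p.1 p.2‖ / (p.1 * p.2) := by
  refine Nut.isBigO_traceRemainder (hK.isBigO_inv hε hdet) (fun i j => ?_) hK.isBigO_commutator
    (fun i j => isBigO_partialXi (uniqueDiffOn_quarterDisc hε) (hK.contDiffOn i j)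
      (zero_mem_quarterDisc hε)) (IsBigO.of_bound 1 ?_)
  · refine IsBigO.of_bound 1 ?_
    filter_upwards [self_mem_nhdsWithin] with p hp
    obtain ⟨hu, hv, -⟩ := mem_interior_quarterDisc.1 hp
    rw [one_mul, Real.norm_of_nonneg (by positivity), diagonal_apply]
    split_ifs
    · exact norm_frameLogDeriv_le hu hv i
    · rw [norm_zero]
      positivity
  · have hsmall : ∀ᶠ p : ℝ × ℝ in 𝓝[interior (quarterDisc ε)] 0, p.1 < 1 :=
      (continuous_fst.continuousAt.mono_left nhdsWithin_le_nhds).eventually_lt_const (by simp)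
    filter_upwards [self_mem_nhdsWithin, hsmall] with p hp hp1
    obtain ⟨hu, hv, -⟩ := mem_interior_quarterDisc.1 hp
    rw [one_mul, norm_one, Real.norm_of_nonneg (by positivity), le_div_iff₀ (by positivity)]
    nlinarith [le_norm_zeta_right (u := p.1) (v := p.2)]

end RegularPart

section ConformalFactor

variable {J K : ℝ → ℝ → Matrix (Fin 3) (Fin 3) ℝ} {ν : ℝ → ℝ → ℝ} {ε r z u v : ℝ}

/-- The logarithm of the conformal factor `e^{2ν} (u² + v²)` of `du² + dv²`. -/
noncomputable def logConformal (ν : ℝ → ℝ → ℝ) (u v : ℝ) : ℝ :=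
  2 * ν (u * v) ((v ^ 2 - u ^ 2) / 2) + Real.log (u ^ 2 + v ^ 2)

lemma exp_logConformal (hu : u ≠ 0) : Real.exp (logConformal ν u v) =
    Real.exp (2 * ν (u * v) ((v ^ 2 - u ^ 2) / 2)) * (u ^ 2 + v ^ 2) := by
  rw [logConformal, Real.exp_add, Real.exp_log (by positivity)]

lemma partialXi_log_mul_exp (hr : r ≠ 0)
    (hν : DifferentiableAt ℝ (fun p : ℝ × ℝ => ν p.1 p.2) (r, z)) :
    partialXi (fun s y => Real.log (s * Real.exp (2 * ν s y))) r z =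
      partialXi (fun s y => 2 * ν s y) r z - Complex.I / (2 * r) := by
  have hlog : (fun p : ℝ × ℝ => Real.log (p.1 * Real.exp (2 * ν p.1 p.2))) =ᶠ[𝓝 (r, z)]
      fun p => 2 * ν p.1 p.2 + Real.log p.1 := by
    filter_upwards [continuous_fst.continuousAt.eventually_ne hr] with p hp
    rw [Real.log_mul hp (Real.exp_ne_zero _), Real.log_exp, add_comm]
  calc _ = partialXi (fun s y => 2 * ν s y + Real.log s) r z := partialXi_congr hlog
    _ = partialXi (fun s y => 2 * ν s y) r z + partialXi (fun s _ => Real.log s) r z :=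
        partialXi_add (hν.const_mul 2) (differentiableAt_fst.log hr)
    _ = _ := by rw [partialXi_log_fst hr]; ring

lemma differentiableAt_comp_weyl {F : ℝ → ℝ → ℝ}
    (h : DifferentiableAt ℝ (fun p : ℝ × ℝ => F p.1 p.2) (u * v, (v ^ 2 - u ^ 2) / 2)) :
    DifferentiableAt ℝ (fun p : ℝ × ℝ => F (p.1 * p.2) ((p.2 ^ 2 - p.1 ^ 2) / 2)) (u, v) :=
  h.comp (u, v) (f := fun p : ℝ × ℝ => (p.1 * p.2, (p.2 ^ 2 - p.1 ^ 2) / 2)) (by fun_prop)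

lemma differentiableAt_log_sq_add_sq (hu : u ≠ 0) :
    DifferentiableAt ℝ (fun p : ℝ × ℝ => Real.log (p.1 ^ 2 + p.2 ^ 2)) (u, v) :=
  DifferentiableAt.log (by fun_prop) (by positivity)

lemma differentiableAt_logConformal (hu : u ≠ 0)
    (hν : DifferentiableAt ℝ (fun p : ℝ × ℝ => ν p.1 p.2) (u * v, (v ^ 2 - u ^ 2) / 2)) :
    DifferentiableAt ℝ (fun p : ℝ × ℝ => logConformal ν p.1 p.2) (u, v) :=
  (differentiableAt_comp_weyl (F := fun r z => 2 * ν r z) (hν.const_mul 2)).fun_add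
    (differentiableAt_log_sq_add_sq hu)

lemma partialXi_logConformal (hu : 0 < u)
    (hν : DifferentiableAt ℝ (fun p : ℝ × ℝ => ν p.1 p.2) (u * v, (v ^ 2 - u ^ 2) / 2)) :
    partialXi (logConformal ν) u v =
      zeta u v * partialXi (fun r z => 2 * ν r z) (u * v) ((v ^ 2 - u ^ 2) / 2) +
        1 / zeta u v := by
  rw [← partialXi_comp_weyl (hν.const_mul 2), ← partialXi_log_sq_add_sq (zeta_ne_zero hu)]
  exact partialXi_add (differentiableAt_comp_weyl (F := fun r z => 2 * ν r z) (hν.const_mul 2))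
    (differentiableAt_log_sq_add_sq hu.ne')

lemma zeta_mul_partialXi_logConformal (hK : IsRegularPart J K ε)
    (hν : SolvesConformalEquation J ν ε) (h : (u, v) ∈ interior (quarterDisc ε)) :
    zeta u v * partialXi (logConformal ν) u v =
      Complex.I * (u * v) / 2 * traceRemainder ((K u v).map Complex.ofReal)
        (diagonal (frameLogDeriv u v)) (matXi K u v) := by
  obtain ⟨hu, hv, -⟩ := mem_interior_quarterDisc.1 h
  have hu' : (u : ℂ) ≠ 0 := mod_cast hu.ne'
  have hv' : (v : ℂ) ≠ 0 := mod_cast hv.ne'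
  have hrz := weyl_mem_halfDisc h
  have hνdiff := hν.differentiableOn_nu.differentiableAt (isOpen_halfDisc.mem_nhds hrz)
  have hunit : IsUnit (K u v).det := by
    rw [hK.det_eq hν.det_eq h]
    exact isUnit_one.neg
  have htrace := zeta_sq_mul_trace_eq hu.ne' hv.ne'
    (fun i j => (hν.differentiableOn_metric i j).differentiableAt (isOpen_halfDisc.mem_nhds hrz))
    (hK.differentiableAt h) hunit
    (eventually_of_mem (isOpen_interior.mem_nhds h) fun p hp => hK.eq_frame_conj p.1 p.2 hp)
  have hequation := hν.partialXi_log_eq _ _ hrz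
  rw [partialXi_log_mul_exp (mul_pos hu hv).ne' hνdiff, sub_eq_iff_eq_add] at hequation
  rw [partialXi_logConformal hu hνdiff, hequation, mul_add,
    mul_one_div_cancel (zeta_ne_zero hu), ← mul_assoc, ← sq, ← sub_eq_iff_eq_add'.2 htrace]
  -- The double poles cancel because `iζ²/(2r) + 1 = (ir/2)(u⁻² - v⁻²)` with `r = uv`.
  have hpoles : zeta u v ^ 2 * (Complex.I / (2 * (u * v))) + 1 =
      Complex.I * (u * v) / 2 * (1 / (u : ℂ) ^ 2 - 1 / (v : ℂ) ^ 2) := by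
    rw [zeta]
    field_simp
    linear_combination (Complex.I * u ^ 2 + 2 * u * v) * Complex.I_sq
  push_cast
  linear_combination hpoles

lemma isBigO_partialXi_logConformal (hε : 0 < ε) (hK : IsRegularPart J K ε)
    (hν : SolvesConformalEquation J ν ε) :
    (fun p : ℝ × ℝ => partialXi (logConformal ν) p.1 p.2)
      =O[𝓝[interior (quarterDisc ε)] 0] fun _ => (1 : ℝ) := by
  have huv : (fun p : ℝ × ℝ => Complex.I * (p.1 * p.2) / 2 * (zeta p.1 p.2)⁻¹)
      =O[𝓝[interior (quarterDisc ε)] 0] fun p => p.1 * p.2 * ‖zeta p.1 p.2‖⁻¹ :=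
    IsBigO.of_bound 1 (.of_forall fun p => by
      simp only [norm_mul, norm_div, norm_inv, Complex.norm_I, Complex.norm_real, norm_norm,
        Complex.norm_ofNat]
      have huv : 0 ≤ ‖p.1‖ * ‖p.2‖ * ‖zeta p.1 p.2‖⁻¹ := by positivity
      linarith)
  refine (huv.mul (hK.isBigO_traceRemainder hε hν.det_eq)).congr' ?_ ?_
  · filter_upwards [self_mem_nhdsWithin] with p hp
    have hzeta := zeta_ne_zero (v := p.2) (mem_interior_quarterDisc.1 hp).1
    apply mul_left_cancel₀ hzeta
    rw [zeta_mul_partialXi_logConformal hK hν hp]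
    field_simp
  · filter_upwards [self_mem_nhdsWithin] with p hp
    obtain ⟨hu, hv, -⟩ := mem_interior_quarterDisc.1 hp
    have hzeta := norm_ne_zero_iff.2 (zeta_ne_zero (v := p.2) hu)
    field_simp

lemma exists_continuous_eventuallyEq_logConformal (hε : 0 < ε) (hK : IsRegularPart J K ε)
    (hν : SolvesConformalEquation J ν ε) :
    ∃ g : ℝ × ℝ → ℝ, Continuous g ∧
      (fun p => logConformal ν p.1 p.2) =ᶠ[𝓝[>] 0 ×ˢ 𝓝[>] 0] g := by
  obtain ⟨C, hC⟩ := (isBigO_partialXi_logConformal hε hK hν).bound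
  simp only [norm_one, mul_one] at hC
  obtain ⟨ρ, hρ, hball⟩ := Metric.mem_nhdsWithin_iff.1 hC
  have hconvex : Convex ℝ (Metric.ball (0 : ℝ × ℝ) ρ ∩ interior (quarterDisc ε)) :=
    (convex_ball _ _).inter convex_quarterDisc.interior
  have hdiff : ∀ p ∈ Metric.ball (0 : ℝ × ℝ) ρ ∩ interior (quarterDisc ε),
      DifferentiableAt ℝ (fun p : ℝ × ℝ => logConformal ν p.1 p.2) p := fun p hp =>
    differentiableAt_logConformal (mem_interior_quarterDisc.1 hp.2).1.ne'
      (hν.differentiableOn_nu.differentiableAt (isOpen_halfDisc.mem_nhds (weyl_mem_halfDisc hp.2)))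
  have hLipschitz : LipschitzOnWith (4 * C).toNNReal (fun p : ℝ × ℝ => logConformal ν p.1 p.2)
      (Metric.ball (0 : ℝ × ℝ) ρ ∩ interior (quarterDisc ε)) := by
    refine hconvex.lipschitzOnWith_of_nnnorm_fderiv_le hdiff fun p hp => ?_
    rw [← NNReal.coe_le_coe, coe_nnnorm]
    exact (norm_fderiv_le_of_norm_partialXi_le (hdiff p hp) (hball hp)).trans
      (Real.le_coe_toNNReal _)
  obtain ⟨g, hg, heq⟩ := hLipschitz.extend_real
  refine ⟨g, hg.continuous, ?_⟩
  rw [← nhdsWithin_interior_quarterDisc hε]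
  exact eventually_of_mem (Metric.mem_nhdsWithin_iff.2 ⟨ρ, hρ, subset_rfl⟩) heq

end ConformalFactor

section Rods

lemma tendsto_integral_div_nhdsGT {f q : ℝ → ℝ} (hf : Continuous f) (hq : q =ᶠ[𝓝[>] 0] f) :
    Tendsto (fun u => (∫ s in (0 : ℝ)..u, q s) / u) (𝓝[>] 0) (𝓝 (f 0)) := by
  have hslope := ((hf.integral_hasStrictDerivAt 0 0).hasDerivAt.tendsto_slope_zero_right)
  obtain ⟨ρ, hρ, hqf⟩ := mem_nhdsGT_iff_exists_Ioc_subset.1 hq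
  refine hslope.congr' ?_
  filter_upwards [Ioc_mem_nhdsGT hρ] with u hu
  have hint : ∫ s in (0 : ℝ)..u, q s = ∫ s in (0 : ℝ)..u, f s := by
    refine intervalIntegral.integral_congr_ae (.of_forall fun s hs => ?_)
    rw [Set.uIoc_of_le hu.1.le] at hs
    exact hqf ⟨hs.1, hs.2.trans hu.2⟩
  rw [zero_add, intervalIntegral.integral_same, sub_zero, smul_eq_mul, hint, div_eq_inv_mul]

lemma eq_exp_of_tendsto_circumference_div_radius {A q h : ℝ → ℝ} {a : ℝ}
    (hA : Tendsto A (𝓝[>] 0) (𝓝 a)) (hh : Continuous h)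
    (hq : q =ᶠ[𝓝[>] 0] fun s => Real.exp (h s))
    (hratio : Tendsto (fun u => 2 * Real.pi * √(u ^ 2 * A u) / ∫ s in (0 : ℝ)..u, √(q s))
      (𝓝[>] 0) (𝓝 (2 * Real.pi))) : a = Real.exp (h 0) := by
  have hradius : Tendsto (fun u => (∫ s in (0 : ℝ)..u, √(q s)) / u) (𝓝[>] 0)
      (𝓝 √(Real.exp (h 0))) :=
    tendsto_integral_div_nhdsGT (f := fun s => √(Real.exp (h s))) (by fun_prop) (hq.fun_comp _)
  have hexp : √(Real.exp (h 0)) ≠ 0 := (Real.sqrt_pos.2 (Real.exp_pos _)).ne'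
  have hlimit : 2 * Real.pi = 2 * Real.pi * √a / √(Real.exp (h 0)) := by
    refine tendsto_nhds_unique hratio (((hA.sqrt.const_mul _).div hradius hexp).congr' ?_)
    filter_upwards [self_mem_nhdsWithin] with u (hu : 0 < u)
    rw [Pi.div_apply, Real.sqrt_mul (sq_nonneg u), Real.sqrt_sq hu.le, div_div_eq_mul_div]
    ring
  have hsqrt : √a = √(Real.exp (h 0)) :=
    (mul_left_cancel₀ Real.two_pi_pos.ne' ((eq_div_iff hexp).1 hlimit)).symm
  have ha : 0 < a := Real.sqrt_pos.1 (hsqrt ▸ Real.sqrt_pos.2 (Real.exp_pos _))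
  exact (Real.sqrt_inj ha.le (Real.exp_pos _).le).1 hsqrt

variable {J K : ℝ → ℝ → Matrix (Fin 3) (Fin 3) ℝ} {ν : ℝ → ℝ → ℝ} {ε u v : ℝ}
  {g : ℝ × ℝ → ℝ}

lemma circumferencePhi_eq (hK : IsRegularPart J K ε) (h : (u, v) ∈ interior (quarterDisc ε)) :
    circumferencePhi J ν u v = 2 * Real.pi * √(u ^ 2 * K u v 1 1) := by
  rw [circumferencePhi, intervalIntegral.integral_const, sub_zero, smul_eq_mul, metric,
    fromBlocks_apply₁₁, hK.eq_frame_conj u v h, mul_diagonal, diagonal_mul]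
  simp only [frame, Matrix.cons_val]
  ring_nf

lemma circumferencePsi_eq (hK : IsRegularPart J K ε) (h : (u, v) ∈ interior (quarterDisc ε)) :
    circumferencePsi J ν u v = 2 * Real.pi * √(v ^ 2 * K u v 2 2) := by
  rw [circumferencePsi, intervalIntegral.integral_const, sub_zero, smul_eq_mul, metric,
    fromBlocks_apply₁₁, hK.eq_frame_conj u v h, mul_diagonal, diagonal_mul]
  simp only [frame, Matrix.cons_val]
  ring_nf

lemma metric_inr_inr (hu : u ≠ 0) (i : Fin 2) :
    metric J ν u v (Sum.inr i) (Sum.inr i) = Real.exp (logConformal ν u v) := by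
  rw [metric, fromBlocks_apply₂₂, Matrix.smul_apply, one_apply_eq, smul_eq_mul, mul_one,
    exp_logConformal hu]

lemma eventually_mk_mem_interior_quarterDisc_left (hv : 0 < v) (hvε : v ^ 2 < 2 * ε) :
    ∀ᶠ u in 𝓝[>] 0, (u, v) ∈ interior (quarterDisc ε) := by
  have hlt : ∀ᶠ u : ℝ in 𝓝 0, u ^ 2 + v ^ 2 < 2 * ε :=
    (show Continuous fun u : ℝ => u ^ 2 + v ^ 2 by fun_prop).continuousAt.eventually_lt_const
      (by simpa using hvε)
  filter_upwards [self_mem_nhdsWithin, hlt.filter_mono nhdsWithin_le_nhds] with u hu hlt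
  exact mem_interior_quarterDisc.2 ⟨hu, hv, hlt⟩

lemma eventually_mk_mem_interior_quarterDisc_right (hu : 0 < u) (huε : u ^ 2 < 2 * ε) :
    ∀ᶠ v in 𝓝[>] 0, (u, v) ∈ interior (quarterDisc ε) := by
  filter_upwards [eventually_mk_mem_interior_quarterDisc_left hu huε] with v hv
  rw [mem_interior_quarterDisc] at hv ⊢
  exact ⟨hv.2.1, hv.1, by linarith [hv.2.2]⟩

lemma eventually_sq_lt (hε : 0 < ε) : ∀ᶠ t : ℝ in 𝓝[>] 0, t ^ 2 < 2 * ε :=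
  ((continuous_pow 2).continuousAt.mono_left nhdsWithin_le_nhds).eventually_lt_const
    (by simpa using hε)

lemma IsRegularPart.eq_exp_left (hK : IsRegularPart J K ε) (hφ : NoConicalPhi J ν ε)
    (hg : Continuous g) (hv : 0 < v) (hvε : v ^ 2 < 2 * ε)
    (hνg : ∀ᶠ u in 𝓝[>] 0, logConformal ν u v = g (u, v)) : K 0 v 1 1 = Real.exp (g (0, v)) := by
  have hmem := eventually_mk_mem_interior_quarterDisc_left hv hvε
  have hrod : (0, v) ∈ quarterDisc ε := ⟨le_rfl, hv.le, by simpa using hvε⟩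
  have htendsto : Tendsto (fun u => (u, v)) (𝓝[>] 0) (𝓝[quarterDisc ε] (0, v)) :=
    tendsto_nhdsWithin_iff.2 ⟨((Continuous.prodMk_left v).tendsto 0).mono_left nhdsWithin_le_nhds,
      hmem.mono fun u hu => interior_subset hu⟩
  refine eq_exp_of_tendsto_circumference_div_radius (h := fun s => g (s, v))
    (q := fun s => metric J ν s v (Sum.inr 0) (Sum.inr 0))
    (((hK.contDiffOn 1 1).continuousOn _ hrod).tendsto.comp htendsto) (by fun_prop) ?_
    ((hφ v hv hvε).congr' ?_)
  · filter_upwards [hνg, self_mem_nhdsWithin] with u hu (hu0 : 0 < u)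
    rw [metric_inr_inr hu0.ne', hu]
  · filter_upwards [hmem] with u hu
    rw [circumferencePhi_eq hK hu, radiusPhi]
    rfl

lemma IsRegularPart.eq_exp_right (hK : IsRegularPart J K ε) (hψ : NoConicalPsi J ν ε)
    (hg : Continuous g) (hu : 0 < u) (huε : u ^ 2 < 2 * ε)
    (hνg : ∀ᶠ v in 𝓝[>] 0, logConformal ν u v = g (u, v)) : K u 0 2 2 = Real.exp (g (u, 0)) := by
  have hmem := eventually_mk_mem_interior_quarterDisc_right hu huε
  have hrod : (u, 0) ∈ quarterDisc ε := ⟨hu.le, le_rfl, by simpa using huε⟩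
  have htendsto : Tendsto (fun v => (u, v)) (𝓝[>] 0) (𝓝[quarterDisc ε] (u, 0)) :=
    tendsto_nhdsWithin_iff.2 ⟨((Continuous.prodMk_right u).tendsto 0).mono_left nhdsWithin_le_nhds,
      hmem.mono fun v hv => interior_subset hv⟩
  refine eq_exp_of_tendsto_circumference_div_radius (h := fun s => g (u, s))
    (q := fun s => metric J ν u s (Sum.inr 1) (Sum.inr 1))
    (((hK.contDiffOn 2 2).continuousOn _ hrod).tendsto.comp htendsto) (by fun_prop) ?_
    ((hψ u hu huε).congr' ?_)
  · filter_upwards [hνg] with v hv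
    rw [metric_inr_inr hu.ne', hv]
  · filter_upwards [hmem] with v hv
    rw [circumferencePsi_eq hK hv, radiusPsi]
    rfl

end Rods

section NormalForm

variable {J : ℝ → ℝ → Matrix (Fin 3) (Fin 3) ℝ} {X Y Z U V W : ℝ → ℝ → ℝ} {ε : ℝ}

/-- The regular part of a metric in nut normal form: the coefficients of
`J = D K D`, `D = diag(1, u, v)`. -/
def nutRegularPart (X Y Z U V W : ℝ → ℝ → ℝ) (u v : ℝ) : Matrix (Fin 3) (Fin 3) ℝ :=
  !![X u v, u * Y u v, v * Z u v;
     u * Y u v, U u v, u * v * V u v;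
     v * Z u v, u * v * V u v, W u v]

/-- The commutator of `nutRegularPart` with `diag(0, -i/(2u), 1/(2v))`, with the poles cancelled. -/
noncomputable def nutCommutator (Y Z V : ℝ → ℝ → ℝ) (u v : ℝ) : Matrix (Fin 3) (Fin 3) ℂ :=
  !![0, Complex.I / 2 * Y u v, -(Z u v / 2);
     -(Complex.I / 2 * Y u v), 0, -((Complex.I * v + u) / 2 * V u v);
     Z u v / 2, (Complex.I * v + u) / 2 * V u v, 0]

lemma commutator_nutRegularPart {u v : ℝ} (hu : u ≠ 0) (hv : v ≠ 0) :
    ⁅diagonal (frameLogDeriv u v), (nutRegularPart X Y Z U V W u v).map Complex.ofReal⁆ =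
      nutCommutator Y Z V u v := by
  have hu' : (u : ℂ) ≠ 0 := mod_cast hu
  have hv' : (v : ℂ) ≠ 0 := mod_cast hv
  ext i j
  rw [commutator_diagonal_apply]
  fin_cases i <;> fin_cases j <;>
    simp only [frameLogDeriv, nutRegularPart, nutCommutator, map_apply, of_apply, Fin.zero_eta,
      Fin.mk_one, Fin.reduceFinMk, cons_val, Complex.ofReal_mul] <;>
    field_simp <;> ring

lemma IsNutNormalForm.continuousOn_nutCommutator (h : IsNutNormalForm J ε X Y Z U V W)
    (i j : Fin 3) :
    ContinuousOn (fun p : ℝ × ℝ => nutCommutator Y Z V p.1 p.2 i j) (quarterDisc ε) := by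
  have hofReal {F : ℝ → ℝ → ℝ} (hF : ContDiffOn ℝ 1 (fun p : ℝ × ℝ => F p.1 p.2)
      (quarterDisc ε)) : ContinuousOn (fun p : ℝ × ℝ => (F p.1 p.2 : ℂ)) (quarterDisc ε) :=
    Complex.continuous_ofReal.comp_continuousOn hF.continuousOn
  have h₀₁ : ContinuousOn (fun p : ℝ × ℝ => Complex.I / 2 * Y p.1 p.2) (quarterDisc ε) :=
    (hofReal h.contDiff_Y).const_mul _
  have h₀₂ : ContinuousOn (fun p : ℝ × ℝ => (Z p.1 p.2 / 2 : ℂ)) (quarterDisc ε) :=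
    (hofReal h.contDiff_Z).div_const 2
  have h₁₂ : ContinuousOn (fun p : ℝ × ℝ => (Complex.I * p.2 + p.1) / 2 * V p.1 p.2)
      (quarterDisc ε) :=
    ContinuousOn.mul (by fun_prop) (hofReal h.contDiff_V)
  fin_cases i <;> fin_cases j
  exacts [continuousOn_const, h₀₁, h₀₂.neg, h₀₁.neg, continuousOn_const, h₁₂.neg, h₀₂, h₁₂,
    continuousOn_const]

lemma IsNutNormalForm.isRegularPart (h : IsNutNormalForm J ε X Y Z U V W) (hε : 0 < ε) :
    IsRegularPart J (nutRegularPart X Y Z U V W) ε where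
  contDiffOn i j := by
    obtain ⟨hX, hY, hZ, hU, hV, hW, -, -, -⟩ := h
    have hu : ContDiffOn ℝ 1 (fun p : ℝ × ℝ => p.1) (quarterDisc ε) := contDiffOn_fst
    have hv : ContDiffOn ℝ 1 (fun p : ℝ × ℝ => p.2) (quarterDisc ε) := contDiffOn_snd
    fin_cases i <;> fin_cases j
    exacts [hX, hu.mul hY, hv.mul hZ, hu.mul hY, hU, (hu.mul hv).mul hV, hv.mul hZ,
      (hu.mul hv).mul hV, hW]
  eq_frame_conj u v huv := by
    obtain ⟨hu, hv, hlt⟩ := mem_interior_quarterDisc.1 huv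
    rw [h.eq_form u v hu hv hlt]
    ext i j
    rw [mul_diagonal, diagonal_mul]
    fin_cases i <;> fin_cases j <;>
      simp only [frame, nutRegularPart, of_apply, Fin.zero_eta, Fin.mk_one, Fin.reduceFinMk,
        cons_val] <;>
      ring
  isBigO_commutator i j := by
    have hlim := h.continuousOn_nutCommutator i j 0 (zero_mem_quarterDisc hε)
    refine (Tendsto.isBigO_one ℝ (hlim.mono interior_subset)).congr' ?_ EventuallyEq.rfl
    filter_upwards [self_mem_nhdsWithin] with p hp
    obtain ⟨hu, hv, -⟩ := mem_interior_quarterDisc.1 hp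
    rw [commutator_nutRegularPart hu.ne' hv.ne']

end NormalForm

end Nut

theorem mainTheorem5_general {J K : ℝ → ℝ → Matrix (Fin 3) (Fin 3) ℝ} {ν : ℝ → ℝ → ℝ} {ε : ℝ}
    (hε : 0 < ε) (hK : Nut.IsRegularPart J K ε) (hν : Nut.SolvesConformalEquation J ν ε)
    (hφ : Nut.NoConicalPhi J ν ε) (hψ : Nut.NoConicalPsi J ν ε) :
    ∃ L : ℝ, Tendsto (fun v => K 0 v 1 1) (𝓝[>] 0) (𝓝 L) ∧
      Tendsto (fun u => K u 0 2 2) (𝓝[>] 0) (𝓝 L) := by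
  obtain ⟨g, hg, hνg⟩ := Nut.exists_continuous_eventuallyEq_logConformal hε hK hν
  have hU : ∀ᶠ v in 𝓝[>] 0, Real.exp (g (0, v)) = K 0 v 1 1 := by
    filter_upwards [self_mem_nhdsWithin, Nut.eventually_sq_lt hε,
      (eventually_swap_iff.1 hνg).curry] with v hv hvε hνv
    exact (hK.eq_exp_left hφ hg hv hvε hνv).symm
  have hW : ∀ᶠ u in 𝓝[>] 0, Real.exp (g (u, 0)) = K u 0 2 2 := by
    filter_upwards [self_mem_nhdsWithin, Nut.eventually_sq_lt hε, hνg.curry] with u hu huε hνu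
    exact (hK.eq_exp_right hψ hg hu huε hνu).symm
  have hexpU : Continuous fun v => Real.exp (g (0, v)) := by fun_prop
  have hexpW : Continuous fun u => Real.exp (g (u, 0)) := by fun_prop
  exact ⟨Real.exp (g (0, 0)), ((hexpU.tendsto 0).mono_left nhdsWithin_le_nhds).congr' hU,
    ((hexpW.tendsto 0).mono_left nhdsWithin_le_nhds).congr' hW⟩

theorem mainTheorem5 (J : ℝ → ℝ → Matrix (Fin 3) (Fin 3) ℝ) (ν : ℝ → ℝ → ℝ) (ε : ℝ)
    (X₀ Y₀ Z₀ U₀ V₀ W₀ : ℝ → ℝ → ℝ) (hε : 0 < ε)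
    (hvac : Nut.IsVacuum J ν ε)
    (hform : Nut.IsNutNormalForm J ε X₀ Y₀ Z₀ U₀ V₀ W₀)
    (hφ : Nut.NoConicalPhi J ν ε) (hψ : Nut.NoConicalPsi J ν ε) :
    ∃ L : ℝ, Tendsto (fun v => U₀ 0 v) (𝓝[>] 0) (𝓝 L) ∧
      Tendsto (fun u => W₀ u 0) (𝓝[>] 0) (𝓝 L) :=
  mainTheorem5_general hε (hform.isRegularPart hε) hvac.solvesConformalEquation hφ hψ
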